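/- Let $\mathcal H$ be a real Hilbert space, $N\ge 1$, let $\mathcal Q\subset\mathcal H$ be nonempty, closed and convex, let $h\colon\mathcal H\to\mathbb R$ be convex and differentiable with $\beta^{-1}$-Lipschitz gradient for some $\beta>0$, and let $f_1,\dots,f_N\colon\mathcal H\to\mathbb R$ be convex and lower semicontinuous (for instance $f_i(x)=\langle a_i,x\rangle+\xi_i$). Let $$\mathcal P_1=\Big\{p\in\mathbb R^N:\sum_{i=1}^N p_i=1\Big\},\qquad \mathcal P_2=\{p\in\mathbb R^N: p\le q\},\qquad \mathcal P_3=\Big\{p\in\mathbb R^N:\mu_-\le\sum_{i=1}^N p_i\xi_i\le\mu_+\Big\},$$ where $q\in\mathbb R^N$, $\xi_1,\dots,\xi_N,\mu_-,\mu_+\in\mathbb R$. Write $N_C$ for the normal cone to a convex set $C$ (with $N_C(x)=\emptyset$ if $x\notin C$), $\partial f$ for the convex subdifferential, $\operatorname{proj}_C$ for the projection onto $C$, $J_A=(\mathrm{Id}+A)^{-1}$ for the resolvent of $A$, and $e_i$ for the canonical vectors of $\mathbb R^N$. For $\mathcal P\in\{\mathcal P_2,\mathcal P_3\}$ define on $\mathcal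 H\times\mathbb R^N$ the operators $$B_i(x,p)=p_i\,\partial f_i(x)\times\big(N_{[0,+\infty[}(p_i)-f_i(x)\big)e_i\ \ (1\le i\le N),\quad A_1(x,p)=N_{\mathcal Q}(x)\times N_{\mathcal P_1}(p),\quad A_{\mathcal P}(x,p)=\{0\}\times N_{\mathcal P}(p),$$ and on $\mathsf H_2=(\mathcal H\times\mathbb R^N)^{N+2}$ the operators $\widetilde A_{\mathcal P}=B_1\times\cdots\times B_N\times A_1\times A_{\mathcal P}$ and $\widetilde C_2(z)=\big((\nabla h(x_1),0),0,\dots,0\big)$ for $z=((x_1,p_1),\dots,(x_{N+2},p_{N+2}))$. Let $V_2=\{z\in\mathsf H_2: z_1=\cdots=z_{N+2}\}$ and consider the problem $$(\mathrm{I}_{\mathcal P})\qquad\text{find } z\in\mathsf H_2\text{ such that } 0\in\widetilde A_{\mathcal P}(z)+\widetilde C_2(z)+N_{V_2}(z).$$ Let $\gamma\in\,]0,2\beta[$, $z^0=((x_i^0,p_i^0))_{i=1}^{N+2}\in V_2$ and $\overline z^0=((\overline x_i^0,\overline p_i^0))_{i=1}^{N+2}\in V_2^\perp$. For every $k\in\mathbb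 N$ let $$\begin{aligned} (\widetilde x_i^k,\widetilde p_i^k)&=J_{\gamma B_i}\Big(x_i^k+\gamma\overline x_i^k-\tfrac{\gamma}{N+2}\nabla h(x_1^k),\;p_i^k+\gamma\overline p_i^k\Big),\qquad 1\le i\le N,\\ (\widetilde x_{N+1}^k,\widetilde p_{N+1}^k)&=\Big(\operatorname{proj}_{\mathcal Q}\big(x_{N+1}^k+\gamma\overline x_{N+1}^k-\tfrac{\gamma}{N+2}\nabla h(x_1^k)\big),\;\operatorname{proj}_{\mathcal P_1}\big(p_{N+1}^k+\gamma\overline p_{N+1}^k\big)\Big),\\ (\widetilde x_{N+2}^k,\widetilde p_{N+2}^k)&=\Big(x_{N+2}^k+\gamma\overline x_{N+2}^k-\tfrac{\gamma}{N+2}\nabla h(x_1^k),\;\operatorname{proj}_{\mathcal P}\big(p_{N+2}^k+\gamma\overline p_{N+2}^k\big)\Big),\\ z_i^{k+1}=(x_i^{k+1},p_i^{k+1})&=\tfrac1{N+2}\sum_{j=1}^{N+2}(\widetilde x_j^k,\widetilde p_j^k),\qquad 1\le i\le N+2,\\ \overline z_i^{k+1}=(\overline x_i^{k+1},\overline p_i^{k+1})&=(\overline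 x_i^k,\overline p_i^k)+\tfrac1\gamma\big(x_i^{k+1}-\widetilde x_i^k,\;p_i^{k+1}-\widetilde p_i^k\big),\qquad 1\le i\le N+2. \end{aligned}$$ Then the following hold. 1. If $\mathcal P=\mathcal P_2$ and problem $(\mathrm I_{\mathcal P_2})$ has at least one solution, then there exists a solution $z\in V_2$ to $(\mathrm I_{\mathcal P_2})$ such that $z^k\rightharpoonup z$ weakly. 2. If $\mathcal P=\mathcal P_3$ and problem $(\mathrm I_{\mathcal P_3})$ has at least one solution, then there exists a solution $z\in V_2$ to $(\mathrm I_{\mathcal P_3})$ such that $z^k\rightharpoonup z$ weakly. -/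

import Mathlib

open Set Filter Topology
open scoped Pointwise InnerProductSpace

noncomputable section

namespace DRO

/-! ### Convex analysis on a real Hilbert space -/

section ConvexAnalysis

variable {E : Type*} [NormedAddCommGroup E] [InnerProductSpace ℝ E]

/-- The convex subdifferential `∂f(x)` of a real-valued function `f`. -/
def subdiff (f : E → ℝ) (x : E) : Set E :=
  {u | ∀ y, f x + ⟪u, y - x⟫_ℝ ≤ f y}

/-- The normal cone `N_C(x)`, which is empty when `x ∉ C`. -/
def normalCone (C : Set E) (x : E) : Set E :=
  {u | x ∈ C ∧ ∀ y ∈ C, ⟪u, y - x⟫_ℝ ≤ 0}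

/-- `J_A u`: the point `y` with `u ∈ y + A y`, that is, `(Id + A)⁻¹ u`. For maximally monotone `A`
it exists and is unique for every `u`. -/
def resolvent (A : E → Set E) (u : E) : E :=
  Classical.epsilon fun y => u ∈ {y} + A y

/-- `proj_C x`: the point of `C` nearest to `x`. For nonempty closed convex `C` in a Hilbert space
it exists and is unique for every `x`. -/
def proj (C : Set E) (x : E) : E :=
  Classical.epsilon fun y => y ∈ C ∧ ∀ w ∈ C, ‖x - y‖ ≤ ‖x - w‖

/-- Weak convergence of a sequence. -/
def WeaklyConverges (z : ℕ → E) (zlim : E) : Prop :=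
  Tendsto (fun k => toWeakSpace ℝ E (z k)) atTop (𝓝 (toWeakSpace ℝ E zlim))

end ConvexAnalysis

/-! ### Ambiguity sets -/

/-- `𝒫₁ = {p | ∑ i, p i = 1}`. -/
def setP1 (N : ℕ) : Set (EuclideanSpace ℝ (Fin N)) :=
  {p | ∑ i, p i = 1}

/-- `𝒫₂ = {p | p ≤ q}`. -/
def setP2 {N : ℕ} (q : Fin N → ℝ) : Set (EuclideanSpace ℝ (Fin N)) :=
  {p | ∀ i, p i ≤ q i}

/-- `𝒫₃ = {p | μ₋ ≤ ∑ i, p i * ξ i ≤ μ₊}`. -/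
def setP3 {N : ℕ} (ξ : Fin N → ℝ) (μm μp : ℝ) : Set (EuclideanSpace ℝ (Fin N)) :=
  {p | μm ≤ ∑ i, p i * ξ i ∧ ∑ i, p i * ξ i ≤ μp}

/-! ### The spaces `ℋ × ℝᴺ` and `(ℋ × ℝᴺ)ᴺ⁺²` with their Hilbert structures -/

/-- `ℋ × ℝᴺ`. -/
abbrev Pair (H : Type*) (N : ℕ) : Type _ := WithLp 2 (H × EuclideanSpace ℝ (Fin N))

/-- `(ℋ × ℝᴺ)ᴺ⁺²`. -/
abbrev Stack (H : Type*) (N : ℕ) : Type _ := PiLp 2 fun _ : Fin (N + 2) => Pair H N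

/-- The element `(x, p)` of `ℋ × ℝᴺ`. -/
abbrev mkPair {H : Type*} {N : ℕ} (x : H) (p : EuclideanSpace ℝ (Fin N)) : Pair H N :=
  WithLp.toLp 2 (x, p)

section Operators

variable {H : Type*} [NormedAddCommGroup H] [InnerProductSpace ℝ H] {N : ℕ}

/-- `B_i(x, p) = (p_i ∂f_i(x)) × (N_{[0,∞)}(p_i) - f_i(x)) e_i`. -/
def opB (f : Fin N → H → ℝ) (i : Fin N) (w : Pair H N) : Set (Pair H N) :=
  {v | ∃ u ∈ subdiff (f i) w.fst, ∃ s ∈ normalCone (Ici (0 : ℝ)) (w.snd i),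
    v = mkPair (w.snd i • u) (EuclideanSpace.single i (s - f i w.fst))}

/-- `A₁(x, p) = N_Q(x) × N_{𝒫₁}(p)`. -/
def opA1 (Q : Set H) (w : Pair H N) : Set (Pair H N) :=
  {v | v.fst ∈ normalCone Q w.fst ∧ v.snd ∈ normalCone (setP1 N) w.snd}

/-- `(x, p) ↦ {0} × N_P(p)`: this is `A₂` for `P = 𝒫₂` and `A₃` for `P = 𝒫₃`. -/
def opA (P : Set (EuclideanSpace ℝ (Fin N))) (w : Pair H N) : Set (Pair H N) :=
  {v | v.fst = 0 ∧ v.snd ∈ normalCone P w.snd}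

/-- The product operator `B₁ × ⋯ × B_N × A₁ × A` on `(ℋ × ℝᴺ)ᴺ⁺²`, where `A(x, p) = {0} × N_P(p)`. -/
def opATilde (f : Fin N → H → ℝ) (Q : Set H) (P : Set (EuclideanSpace ℝ (Fin N)))
    (z : Stack H N) : Set (Stack H N) :=
  {v | ∀ i, v i ∈ Fin.append (opB f) ![opA1 Q, opA P] i (z i)}

/-- `z ↦ ((∇h(x₁), 0), 0, …, 0)`, where `z₁ = (x₁, p₁)`. -/
def opCTilde [CompleteSpace H] (h : H → ℝ) (z : Stack H N) : Stack H N :=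
  WithLp.toLp 2 fun i => if i = 0 then mkPair (gradient h (z 0).fst) 0 else 0

variable (H N) in
/-- The diagonal subspace `V₂ = {z | z₁ = ⋯ = z_{N+2}}`. -/
def diag : Submodule ℝ (Stack H N) where
  carrier := {z | ∀ i j, z i = z j}
  add_mem' := by
    intro a b ha hb i j
    simp only [PiLp.add_apply, ha i j, hb i j]
  zero_mem' := by
    intro i j
    simp
  smul_mem' := by
    intro c a ha i j
    simp only [PiLp.smul_apply, ha i j]

/-- `z` solves the inclusion `0 ∈ Ã(z) + C̃(z) + N_{V₂}(z)`. -/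
def IsSolution [CompleteSpace H] (h : H → ℝ) (f : Fin N → H → ℝ) (Q : Set H)
    (P : Set (EuclideanSpace ℝ (Fin N))) (z : Stack H N) : Prop :=
  (0 : Stack H N) ∈
    opATilde f Q P z + {opCTilde h z} + normalCone (diag H N : Set (Stack H N)) z

/-- The forward-backward routine with subspaces. Here `z k = (x_i^k, p_i^k)_i`,
`zbar k = (x̄_i^k, p̄_i^k)_i` and `ztil k = (x̃_i^k, p̃_i^k)_i`. The indices `1, …, N` are
`Fin.castAdd 2 i`, and `N + 1`, `N + 2` are `Fin.natAdd N 0`, `Fin.natAdd N 1`. -/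
structure IsRoutine [CompleteSpace H] (h : H → ℝ) (f : Fin N → H → ℝ) (Q : Set H)
    (P : Set (EuclideanSpace ℝ (Fin N))) (γ : ℝ) (z zbar ztil : ℕ → Stack H N) : Prop where
  step_B : ∀ (k : ℕ) (i : Fin N), ztil k (Fin.castAdd 2 i) =
    resolvent (fun w => γ • opB f i w)
      (mkPair
        ((z k (Fin.castAdd 2 i)).fst + γ • (zbar k (Fin.castAdd 2 i)).fst
          - (γ / (N + 2)) • gradient h (z k 0).fst)
        ((z k (Fin.castAdd 2 i)).snd + γ • (zbar k (Fin.castAdd 2 i)).snd))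
  step_A1 : ∀ k : ℕ, ztil k (Fin.natAdd N 0) =
    mkPair
      (proj Q ((z k (Fin.natAdd N 0)).fst + γ • (zbar k (Fin.natAdd N 0)).fst
        - (γ / (N + 2)) • gradient h (z k 0).fst))
      (proj (setP1 N) ((z k (Fin.natAdd N 0)).snd + γ • (zbar k (Fin.natAdd N 0)).snd))
  step_A : ∀ k : ℕ, ztil k (Fin.natAdd N 1) =
    mkPair
      ((z k (Fin.natAdd N 1)).fst + γ • (zbar k (Fin.natAdd N 1)).fst
        - (γ / (N + 2)) • gradient h (z k 0).fst)
      (proj P ((z k (Fin.natAdd N 1)).snd + γ • (zbar k (Fin.natAdd N 1)).snd))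
  step_z : ∀ (k : ℕ) (i : Fin (N + 2)),
    z (k + 1) i = ((1 : ℝ) / (N + 2)) • ∑ j, ztil k j
  step_zbar : ∀ (k : ℕ) (i : Fin (N + 2)),
    zbar (k + 1) i = zbar k i + (1 / γ) • (z (k + 1) i - ztil k i)

end Operators

end DRO

end

open DRO

namespace DRO

section HilbertSpace

variable {E : Type*} [NormedAddCommGroup E] [InnerProductSpace ℝ E]

/-! ### Convex functions -/

/-! On the diagonal `V` the normal cone is `Vᗮ`, so only the projection `D` of the smooth term onto
`V` matters: the remainder is absorbed by `Vᗮ`. Solving the inclusion means finding `s ∈ V` and `y ∈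
Vᗮ` with `y - D s ∈ A s`, where `A` is the product operator, and the routine is the
forward–partial-inverse iteration for this primal-dual problem.

Convergence rests on the Lyapunov function `‖z k - s‖² + γ² ‖zb k - y‖²`. Monotonicity of `A`,
orthogonality of `V` and `Vᗮ`, and cocoercivity of `D` (Baillon–Haddad) make it decrease, strictly
enough when `γ < 2β` that `z (k+1) - z k`, `zb (k+1) - zb k` and `D (z k) - D s` tend to `0`
(`fejer`). Maximality of `A` then makes every weak cluster point a solution, and Opial's argument
leaves only one (`exists_weak_limit`).

Monotonicity of `B_i` reflects the convex-concave saddle structure of `p_i f_i(x)`. Maximality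
follows from solvability of the resolvent equation, which for `B_i` is the optimality system of a
projection onto an epigraph (`exists_epigraph_projection`). -/

theorem continuous_of_convexOn_of_lowerSemicontinuous [CompleteSpace E] {f : E → ℝ}
    (hf : ConvexOn ℝ univ f) (hlsc : LowerSemicontinuous f) : Continuous f := by
  -- Baire: the closed sublevel sets at integer heights cover the space, so one has an interior
  -- point. A convex function bounded above near one point is continuous everywhere.
  obtain ⟨n, x₀, hx₀⟩ := nonempty_interior_of_iUnion_of_closed
    (f := fun n : ℕ => f ⁻¹' Iic (n : ℝ))
    (fun n => lowerSemicontinuous_iff_isClosed_preimage.1 hlsc n)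
    (by
      refine eq_univ_of_forall fun x => mem_iUnion.2 ?_
      obtain ⟨n, hn⟩ := exists_nat_ge (f x)
      exact ⟨n, hn⟩)
  have hbdd : IsBoundedUnder (· ≤ ·) (𝓝 x₀) f :=
    isBoundedUnder_of_eventually_le (a := (n : ℝ)) (mem_interior_iff_mem_nhds.1 hx₀)
  rw [← continuousOn_univ]
  have hiff := (ConvexOn.continuousOn_tfae isOpen_univ univ_nonempty hf).out 3 1
  exact hiff.1 ⟨x₀, mem_univ _, hbdd⟩

/-- Separate the open strict epigraph from the point `(x, f x)`. The separating functional has a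
negative vertical component; dividing by its absolute value turns the horizontal part into a
subgradient. -/
theorem subdiff_nonempty [CompleteSpace E] {f : E → ℝ} (hf : ConvexOn ℝ univ f)
    (hc : Continuous f) (x : E) : (subdiff f x).Nonempty := by
  have hopen : IsOpen {p : E × ℝ | p.1 ∈ univ ∧ f p.1 < p.2} := by
    simpa using isOpen_lt (hc.comp continuous_fst) continuous_snd
  obtain ⟨L, hL⟩ := geometric_hahn_banach_open_point hf.convex_strict_epigraph hopen
    (x := (x, f x)) (by simp)
  have hsplit : ∀ (y : E) (t : ℝ), L (y, t) = L (y, 0) + t * L (0, 1) := by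
    intro y t
    rw [← smul_eq_mul, ← map_smul, ← map_add]
    simp
  have hneg : L (0, 1) < 0 := by
    have := hL (x, f x + 1) (by simp)
    rw [hsplit x (f x + 1), hsplit x (f x)] at this
    linarith
  set c := L (0, 1) with hc'
  let ℓ : StrongDual ℝ E := L.comp (ContinuousLinearMap.inl ℝ E ℝ)
  have hℓ : ∀ y, ⟪(InnerProductSpace.toDual ℝ E).symm ℓ, y⟫_ℝ = L (y, 0) := fun y => by
    rw [InnerProductSpace.toDual_symm_apply]; rfl
  refine ⟨(-c)⁻¹ • (InnerProductSpace.toDual ℝ E).symm ℓ, fun y => ?_⟩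
  have key : L (y, 0) - L (x, 0) ≤ (-c) * (f y - f x) := by
    refine le_of_forall_pos_lt_add fun ε hε => ?_
    have := hL (y, f y + ε / (-c)) (by simpa using div_pos hε (neg_pos.2 hneg))
    rw [hsplit y, hsplit x (f x)] at this
    have h2 : ε / (-c) * c = -ε := by
      have := hneg.ne
      field_simp
    nlinarith
  rw [real_inner_smul_left, inner_sub_right, hℓ, hℓ]
  have h3 : (-c)⁻¹ * (L (y, 0) - L (x, 0)) ≤ f y - f x := by
    rw [inv_mul_le_iff₀ (neg_pos.2 hneg)]
    exact key
  linarith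

theorem add_inner_gradient_le [CompleteSpace E] {h : E → ℝ} (hconv : ConvexOn ℝ univ h)
    (hdiff : Differentiable ℝ h) (x y : E) : h x + ⟪gradient h x, y - x⟫_ℝ ≤ h y := by
  have hline : HasDerivAt (fun t : ℝ => h (AffineMap.lineMap x y t)) ⟪gradient h x, y - x⟫_ℝ 0 := by
    have h1 : HasFDerivAt h (InnerProductSpace.toDual ℝ E (gradient h x))
        (AffineMap.lineMap x y (0 : ℝ)) := by
      simpa using (hdiff x).hasGradientAt.hasFDerivAt
    exact h1.comp_hasDerivAt (0 : ℝ) AffineMap.hasDerivAt_lineMap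
  have hcv : ConvexOn ℝ univ (fun t : ℝ => h (AffineMap.lineMap x y t)) :=
    hconv.comp_affineMap (AffineMap.lineMap x y)
  have := hcv.le_slope_of_hasDerivAt (mem_univ 0) (mem_univ 1) one_pos hline
  simp only [slope_def_field, AffineMap.lineMap_apply_one, AffineMap.lineMap_apply_zero,
    sub_zero, div_one] at this
  linarith

theorem le_add_inner_gradient_add_sq [CompleteSpace E] {h : E → ℝ} {L : ℝ}
    (hdiff : Differentiable ℝ h)
    (hlip : ∀ x y, ‖gradient h x - gradient h y‖ ≤ L * ‖x - y‖) (x y : E) :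
    h y ≤ h x + ⟪gradient h x, y - x⟫_ℝ + L / 2 * ‖y - x‖ ^ 2 := by
  have hline : ∀ t : ℝ, HasDerivAt (fun t : ℝ => h (x + t • (y - x)) -
      t * ⟪gradient h x, y - x⟫_ℝ - t ^ 2 * (L / 2 * ‖y - x‖ ^ 2))
      (⟪gradient h (x + t • (y - x)), y - x⟫_ℝ - ⟪gradient h x, y - x⟫_ℝ
        - 2 * t * (L / 2 * ‖y - x‖ ^ 2)) t := by
    intro t
    have h1 : HasFDerivAt h (InnerProductSpace.toDual ℝ E (gradient h (x + t • (y - x))))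
        (x + t • (y - x)) := (hdiff _).hasGradientAt.hasFDerivAt
    have h0 : HasDerivAt (fun t : ℝ => x + t • (y - x)) (y - x) t := by
      simpa using ((hasDerivAt_id t).smul_const (y - x)).const_add x
    have h2 := h1.comp_hasDerivAt t h0
    have h3 := ((hasDerivAt_id t).mul_const ⟪gradient h x, y - x⟫_ℝ)
    have h4 := ((hasDerivAt_pow 2 t).mul_const (L / 2 * ‖y - x‖ ^ 2))
    refine ((h2.sub h3).sub h4).congr_deriv ?_
    rw [InnerProductSpace.toDual_apply_apply]
    norm_num
  have hanti := antitoneOn_of_deriv_nonpos (convex_Icc (0 : ℝ) 1)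
    (fun t _ => (hline t).continuousAt.continuousWithinAt)
    (fun t _ => (hline t).differentiableAt.differentiableWithinAt)
    (fun t ht => by
      rw [interior_Icc] at ht
      rw [(hline t).deriv, ← inner_sub_left]
      have h1 := real_inner_le_norm (gradient h (x + t • (y - x)) - gradient h x) (y - x)
      have h2 := hlip (x + t • (y - x)) x
      rw [add_sub_cancel_left, norm_smul, Real.norm_of_nonneg ht.1.le] at h2
      nlinarith [mul_le_mul_of_nonneg_right h2 (norm_nonneg (y - x))])
  have := hanti (left_mem_Icc.2 zero_le_one) (right_mem_Icc.2 zero_le_one) zero_le_one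
  simp only [one_smul, zero_smul, add_zero, add_sub_cancel] at this
  linarith

/-- The Baillon–Haddad theorem: a `β⁻¹`-Lipschitz gradient of a convex function is
`β`-cocoercive. -/
theorem gradient_cocoercive [CompleteSpace E] {h : E → ℝ} {β : ℝ} (hβ : 0 < β)
    (hconv : ConvexOn ℝ univ h) (hdiff : Differentiable ℝ h)
    (hlip : ∀ x y, ‖gradient h x - gradient h y‖ ≤ β⁻¹ * ‖x - y‖) (x y : E) :
    β * ‖gradient h x - gradient h y‖ ^ 2 ≤ ⟪gradient h x - gradient h y, x - y⟫_ℝ := by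
  have key : ∀ x y : E, h x + ⟪gradient h x, y - x⟫_ℝ
      + β / 2 * ‖gradient h y - gradient h x‖ ^ 2 ≤ h y := by
    intro x y
    set g := gradient h y - gradient h x with hg
    -- The point `y - β • g` minimizes the quadratic upper model at `y` of `h` minus its
    -- linearization at `x`; convexity at `x` and the descent bound at `y` are compared there.
    have h1 := add_inner_gradient_le hconv hdiff x (y - β • g)
    have h2 := le_add_inner_gradient_add_sq hdiff hlip y (y - β • g)
    rw [sub_sub_cancel_left, norm_neg, norm_smul, Real.norm_of_nonneg hβ.le, inner_neg_right,
      real_inner_smul_right] at h2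
    rw [sub_right_comm, inner_sub_right, real_inner_smul_right] at h1
    have h3 : ‖g‖ ^ 2 = ⟪gradient h y, g⟫_ℝ - ⟪gradient h x, g⟫_ℝ := by
      rw [← inner_sub_left, ← hg, real_inner_self_eq_norm_sq]
    have h4 : β⁻¹ / 2 * (β * ‖g‖) ^ 2 = β / 2 * ‖g‖ ^ 2 := by field_simp
    nlinarith
  have h1 := key x y
  have h2 := key y x
  rw [norm_sub_rev] at h1
  have h3 : ⟪gradient h x - gradient h y, x - y⟫_ℝ
      = -⟪gradient h x, y - x⟫_ℝ - ⟪gradient h y, x - y⟫_ℝ := by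
    rw [inner_sub_left, ← inner_neg_right, neg_sub]
  linarith

/-! ### Projections and normal cones -/

theorem exists_sub_mem_normalCone [CompleteSpace E] {C : Set E} (hne : C.Nonempty)
    (hcl : IsClosed C) (hconv : Convex ℝ C) (x : E) : ∃ y, x - y ∈ normalCone C y := by
  obtain ⟨y, hy, hmin⟩ := exists_norm_eq_iInf_of_complete_convex hne hcl.isComplete hconv x
  exact ⟨y, hy, (norm_eq_iInf_iff_real_inner_le_zero hconv hy).1 hmin⟩

theorem sub_proj_mem_normalCone [CompleteSpace E] {C : Set E} (hne : C.Nonempty)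
    (hcl : IsClosed C) (hconv : Convex ℝ C) (x : E) : x - proj C x ∈ normalCone C (proj C x) := by
  obtain ⟨y, hy, hmin⟩ := exists_norm_eq_iInf_of_complete_convex hne hcl.isComplete hconv x
  have hbdd : BddBelow (range fun w : C => ‖x - w‖) := ⟨0, by rintro _ ⟨w, rfl⟩; positivity⟩
  have hspec : proj C x ∈ C ∧ ∀ w ∈ C, ‖x - proj C x‖ ≤ ‖x - w‖ :=
    Classical.epsilon_spec (p := fun y => y ∈ C ∧ ∀ w ∈ C, ‖x - y‖ ≤ ‖x - w‖)
      ⟨y, hy, fun w hw => hmin ▸ ciInf_le hbdd ⟨w, hw⟩⟩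
  refine ⟨hspec.1, (norm_eq_iInf_iff_real_inner_le_zero hconv hspec.1).1 ?_⟩
  have : Nonempty C := hne.to_subtype
  exact le_antisymm (le_ciInf fun w => hspec.2 w w.2) (ciInf_le hbdd ⟨_, hspec.1⟩)

theorem smul_mem_normalCone {C : Set E} {x u : E} (hu : u ∈ normalCone C x) {c : ℝ}
    (hc : 0 ≤ c) : c • u ∈ normalCone C x :=
  ⟨hu.1, fun y hy => by
    rw [real_inner_smul_left]
    exact mul_nonpos_of_nonneg_of_nonpos hc (hu.2 y hy)⟩

theorem normalCone_monotone {C : Set E} {x y u v : E} (hu : u ∈ normalCone C x)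
    (hv : v ∈ normalCone C y) : 0 ≤ ⟪u - v, x - y⟫_ℝ := by
  have h1 := hu.2 y hv.1
  have h2 := hv.2 x hu.1
  rw [← neg_sub, inner_neg_right] at h1
  rw [inner_sub_left]
  linarith

theorem mem_normalCone_submodule {V : Submodule ℝ E} {x u : E} :
    u ∈ normalCone (V : Set E) x ↔ x ∈ V ∧ u ∈ Vᗮ := by
  refine and_congr_right fun hx => ⟨fun h => ?_, fun h y hy => ?_⟩
  · rw [Submodule.mem_orthogonal']
    intro v hv
    have h1 := h (x + v) (V.add_mem hx hv)
    have h2 := h (x - v) (V.sub_mem hx hv)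
    simp only [add_sub_cancel_left, sub_sub_cancel_left, inner_neg_right] at h1 h2
    linarith
  · exact ((Submodule.mem_orthogonal' V u).1 h _ (V.sub_mem hy hx)).le

/-! ### Weak limits -/

/-- Banach–Alaoglu transported by the Riesz isomorphism. Ultrafilters play the role of weakly
convergent subsequences. -/
theorem exists_weak_limit_of_bounded [CompleteSpace E] {ι : Type*} (U : Ultrafilter ι)
    {x : ι → E} {M : ℝ} (hM : ∀ i, ‖x i‖ ≤ M) :
    ∃ w, ∀ v, Tendsto (fun i => ⟪x i, v⟫_ℝ) U (𝓝 ⟪w, v⟫_ℝ) := by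
  let φ : ι → WeakDual ℝ E := fun i =>
    StrongDual.toWeakDual (InnerProductSpace.toDual ℝ E (x i))
  have hK := WeakDual.isCompact_closedBall (𝕜 := ℝ) (0 : StrongDual ℝ E) M
  obtain ⟨ψ, -, hψ⟩ := hK.ultrafilter_le_nhds (U.map φ) (by
    refine le_principal_iff.2 (Filter.mem_map.2 (univ_mem' fun i => ?_))
    simpa [φ] using hM i)
  refine ⟨(InnerProductSpace.toDual ℝ E).symm (WeakDual.toStrongDual ψ), fun v => ?_⟩
  rw [InnerProductSpace.toDual_symm_apply]
  exact ((WeakDual.eval_continuous v).tendsto ψ).comp hψ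

theorem weaklyConverges_of_inner [CompleteSpace E] {z : ℕ → E} {w : E}
    (h : ∀ v, Tendsto (fun k => ⟪z k, v⟫_ℝ) atTop (𝓝 ⟪w, v⟫_ℝ)) : WeaklyConverges z w := by
  have hinj : Function.Injective (topDualPairing ℝ E).flip := by
    intro a b hab
    refine ext_inner_left ℝ fun v => ?_
    exact LinearMap.congr_fun hab (InnerProductSpace.toDual ℝ E v)
  refine (WeakBilin.tendsto_iff_forall_eval_tendsto _ hinj).2 fun ℓ => ?_
  have := h ((InnerProductSpace.toDual ℝ E).symm ℓ)
  simp only [real_inner_comm ((InnerProductSpace.toDual ℝ E).symm ℓ),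
    InnerProductSpace.toDual_symm_apply] at this
  exact this

theorem tendsto_inner_zero_of_bounded {ι : Type*} {l : Filter ι} {x y : ι → E} {M : ℝ}
    (hx : Tendsto x l (𝓝 0)) (hM : ∀ i, ‖y i‖ ≤ M) :
    Tendsto (fun i => ⟪x i, y i⟫_ℝ) l (𝓝 0) := by
  have h0 : Tendsto (fun i => ‖x i‖ * M) l (𝓝 0) := by simpa using hx.norm.mul_const M
  exact squeeze_zero_norm (fun i => (norm_inner_le_norm _ _).trans
    (mul_le_mul_of_nonneg_left (hM i) (norm_nonneg _))) h0

end HilbertSpace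

end DRO

namespace DRO

/-! ### Fejér monotonicity and weak convergence of the forward–partial-inverse iteration -/

section ForwardPartialInverse

theorem exists_pos_mul_add_sq_le {γ β : ℝ} (hγ : 0 < γ) (hγβ : γ < 2 * β) :
    ∃ c > 0, c ≤ 1 ∧ ∀ a b : ℝ,
      c * (a ^ 2 + b ^ 2) ≤ a ^ 2 - 2 * γ * (a * b) + 2 * γ * β * b ^ 2 := by
  obtain ⟨δ, hδ0, hδ⟩ : ∃ δ > 0, 2 * γ * β = γ ^ 2 + δ :=
    ⟨2 * γ * β - γ ^ 2, by nlinarith, by ring⟩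
  -- The quadratic form on the right has determinant `δ` and trace `1 + γ ^ 2 + δ`; their quotient
  -- is a lower bound for its smallest eigenvalue.
  refine ⟨δ / (1 + γ ^ 2 + δ), by positivity, ?_, fun a b => ?_⟩
  · rw [div_le_one (by positivity)]
    nlinarith [sq_nonneg γ]
  · rw [div_mul_eq_mul_div, div_le_iff₀ (by positivity), hδ]
    nlinarith [sq_nonneg ((1 + γ ^ 2) * a - γ * (1 + γ ^ 2 + δ) * b), sq_nonneg (a - γ * b),
      sq_nonneg (γ * a - (γ ^ 2 + δ) * b), sq_nonneg b, sq_nonneg a, sq_nonneg (δ * b)]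

theorem tendsto_zero_of_mul_sq_norm_le {E : Type*} [NormedAddCommGroup E] {x : ℕ → E} {g : ℕ → ℝ} {c : ℝ} (hc : 0 < c)
    (hx : ∀ k, c * ‖x k‖ ^ 2 ≤ g k) (hg : Tendsto g atTop (𝓝 0)) : Tendsto x atTop (𝓝 0) := by
  have h1 : Tendsto (fun k => √(c⁻¹ * g k)) atTop (𝓝 0) := by
    simpa using (hg.const_mul c⁻¹).sqrt
  refine squeeze_zero_norm (fun k => Real.le_sqrt_of_sq_le ?_) h1
  rw [le_inv_mul_iff₀ hc]
  exact hx k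

theorem exists_norm_le_of_mul_sq_norm_sub_le {E : Type*} [NormedAddCommGroup E] {x : ℕ → E} {s : E} {g : ℕ → ℝ} {c l : ℝ}
    (hc : 0 < c) (hx : ∀ k, c * ‖x k - s‖ ^ 2 ≤ g k) (hg : Tendsto g atTop (𝓝 l)) :
    ∃ M, ∀ k, ‖x k‖ ≤ M := by
  obtain ⟨B, hB⟩ := hg.bddAbove_range
  refine ⟨√(c⁻¹ * B) + ‖s‖, fun k => ?_⟩
  have h1 : ‖x k - s‖ ≤ √(c⁻¹ * B) := by
    refine Real.le_sqrt_of_sq_le ?_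
    rw [le_inv_mul_iff₀ hc]
    exact (hx k).trans (hB ⟨k, rfl⟩)
  linarith [norm_sub_norm_le (x k) s]

variable {E : Type*} [NormedAddCommGroup E] [InnerProductSpace ℝ E]

/-- The forward–partial-inverse iteration for `0 ∈ A z + D z + N_V z`, where
`(z k, zb k) ∈ V × Vᗮ` and `zt k` is the resolvent step. -/
structure ForwardPartialInverse (V : Submodule ℝ E) (A : E → Set E) (D : E → E) (γ : ℝ)
    (z zb zt : ℕ → E) : Prop where
  mem : ∀ k, z k ∈ V
  mem_orthogonal : ∀ k, zb k ∈ Vᗮ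
  resolvent_step : ∀ k, γ⁻¹ • (z k - zt k) + zb k - D (z k) ∈ A (zt k)
  projection_step : ∀ k, z (k + 1) - zt k ∈ Vᗮ
  dual_step : ∀ k, zb (k + 1) = zb k + γ⁻¹ • (z (k + 1) - zt k)

variable {V : Submodule ℝ E} {A : E → Set E} {D : E → E} {β γ : ℝ} {z zb zt : ℕ → E}

namespace ForwardPartialInverse

theorem sub_eq (hr : ForwardPartialInverse V A D γ z zb zt) (hγ : 0 < γ) (k : ℕ) :
    zt k - z k = (z (k + 1) - z k) - γ • (zb (k + 1) - zb k) := by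
  rw [hr.dual_step k, add_sub_cancel_left, smul_inv_smul₀ hγ.ne']
  abel

/-- Monotonicity is applied to the graph points over `zt k` and `s`. Orthogonality removes all
pairings between `V` and `Vᗮ`, and cocoercivity with Cauchy–Schwarz leaves the quadratic form of
`hc` in `‖p‖` and `‖d‖`. -/
theorem fejer (hr : ForwardPartialInverse V A D γ z zb zt) (hγ : 0 < γ)
    (hmono : ∀ x y, ∀ u ∈ A x, ∀ v ∈ A y, 0 ≤ ⟪u - v, x - y⟫_ℝ)
    (hDV : ∀ x, D x ∈ V)
    (hD : ∀ x ∈ V, ∀ y ∈ V, β * ‖D x - D y‖ ^ 2 ≤ ⟪D x - D y, x - y⟫_ℝ)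
    {c : ℝ} (hc1 : c ≤ 1) (hc : ∀ a b : ℝ,
      c * (a ^ 2 + b ^ 2) ≤ a ^ 2 - 2 * γ * (a * b) + 2 * γ * β * b ^ 2)
    {s y : E} (hs : s ∈ V) (hy : y ∈ Vᗮ) (hsy : y - D s ∈ A s) (k : ℕ) :
    c * (‖z (k + 1) - z k‖ ^ 2 + ‖D (z k) - D s‖ ^ 2 + γ ^ 2 * ‖zb (k + 1) - zb k‖ ^ 2)
      + (‖z (k + 1) - s‖ ^ 2 + γ ^ 2 * ‖zb (k + 1) - y‖ ^ 2)
      ≤ ‖z k - s‖ ^ 2 + γ ^ 2 * ‖zb k - y‖ ^ 2 := by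
  have h0 := hmono _ _ _ (hr.resolvent_step k) _ hsy
  have horth : ∀ u ∈ V, ∀ v ∈ Vᗮ, ⟪u, v⟫_ℝ = 0 := fun u hu v hv =>
    (Submodule.mem_orthogonal V v).1 hv u hu
  set p := z (k + 1) - z k with hp
  set r := zb (k + 1) - zb k with hrr
  set d := D (z k) - D s with hd
  set a := z k - s with ha
  set b := zb k - y with hb
  have hpV : p ∈ V := V.sub_mem (hr.mem _) (hr.mem _)
  have haV : a ∈ V := V.sub_mem (hr.mem _) hs
  have hdV : d ∈ V := V.sub_mem (hDV _) (hDV _)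
  have hrV : r ∈ Vᗮ := Vᗮ.sub_mem (hr.mem_orthogonal _) (hr.mem_orthogonal _)
  have hbV : b ∈ Vᗮ := Vᗮ.sub_mem (hr.mem_orthogonal _) hy
  have hzt : zt k - z k = p - γ • r := hr.sub_eq hγ k
  have e1 : γ⁻¹ • (z k - zt k) + zb k - D (z k) - (y - D s) = r + b - d - γ⁻¹ • p := by
    rw [← neg_sub (zt k), hzt, smul_neg, smul_sub, inv_smul_smul₀ hγ.ne']
    simp only [hb, hd]
    abel
  have e2 : zt k - s = a + p - γ • r := by
    rw [← sub_add_sub_cancel (zt k) (z k) s, hzt]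
    simp only [ha]
    abel
  rw [e1, e2] at h0
  have e3 : z (k + 1) - s = a + p := by simp only [ha, hp]; abel
  have e4 : zb (k + 1) - y = b + r := by simp only [hb, hrr]; abel
  rw [e3, e4, norm_add_sq_real, norm_add_sq_real, real_inner_comm r b]
  have hcoc := hD _ (hr.mem k) _ hs
  rw [← hd, ← ha] at hcoc
  have hcs : -⟪d, p⟫_ℝ ≤ ‖d‖ * ‖p‖ := (neg_le_abs _).trans (abs_real_inner_le_norm d p)
  simp only [inner_sub_left, inner_add_left, inner_sub_right, inner_add_right,
    real_inner_smul_left, real_inner_smul_right, horth a haV r hrV, horth p hpV r hrV,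
    horth d hdV r hrV, real_inner_comm a b, real_inner_comm p b, real_inner_comm a r,
    real_inner_comm p r, horth a haV b hbV, horth p hpV b hbV, real_inner_self_eq_norm_sq,
    real_inner_comm a p, real_inner_comm r b] at h0
  have h1 := mul_nonneg hγ.le h0
  have hq := hc ‖p‖ ‖d‖
  have hr2 : c * (γ ^ 2 * ‖r‖ ^ 2) ≤ γ ^ 2 * ‖r‖ ^ 2 :=
    mul_le_of_le_one_left (by positivity) hc1
  have e5 : γ * (γ⁻¹ * ⟪a, p⟫_ℝ) = ⟪a, p⟫_ℝ := mul_inv_cancel_left₀ hγ.ne' _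
  have e6 : γ * (γ⁻¹ * ‖p‖ ^ 2) = ‖p‖ ^ 2 := mul_inv_cancel_left₀ hγ.ne' _
  have h2 := mul_le_mul_of_nonneg_left hcs hγ.le
  have h3 := mul_le_mul_of_nonneg_left hcoc hγ.le
  nlinarith

theorem exists_weak_limit [CompleteSpace E] (hr : ForwardPartialInverse V A D γ z zb zt)
    (hV : IsClosed (V : Set E)) (hγ : 0 < γ) (hγβ : γ < 2 * β)
    (hmono : ∀ x y, ∀ u ∈ A x, ∀ v ∈ A y, 0 ≤ ⟪u - v, x - y⟫_ℝ)
    (hmax : ∀ x u, (∀ y, ∀ v ∈ A y, 0 ≤ ⟪u - v, x - y⟫_ℝ) → u ∈ A x)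
    (hDV : ∀ x, D x ∈ V)
    (hD : ∀ x ∈ V, ∀ y ∈ V, β * ‖D x - D y‖ ^ 2 ≤ ⟪D x - D y, x - y⟫_ℝ)
    (hsol : ∃ s ∈ V, ∃ y ∈ Vᗮ, y - D s ∈ A s) :
    ∃ w ∈ V, (∃ y ∈ Vᗮ, y - D w ∈ A w) ∧
      ∀ v, Tendsto (fun k => ⟪z k, v⟫_ℝ) atTop (𝓝 ⟪w, v⟫_ℝ) := by
  have hβ : 0 < β := by linarith
  obtain ⟨c, hc0, hc1, hc⟩ := exists_pos_mul_add_sq_le hγ hγβ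
  obtain ⟨s, hs, t, ht, hst⟩ := hsol
  have horth : ∀ u ∈ V, ∀ v ∈ Vᗮ, ⟪u, v⟫_ℝ = 0 := fun u hu v hv =>
    (Submodule.mem_orthogonal V v).1 hv u hu
  have hfejer := fun {s y : E} (hs : s ∈ V) (hy : y ∈ Vᗮ) (hsy : y - D s ∈ A s) (k : ℕ) =>
    hr.fejer hγ hmono hDV hD hc1 hc hs hy hsy k
  -- convergence of the Lyapunov functions
  have hconv : ∀ s ∈ V, ∀ y ∈ Vᗮ, y - D s ∈ A s →
      ∃ l, Tendsto (fun k => ‖z k - s‖ ^ 2 + γ ^ 2 * ‖zb k - y‖ ^ 2) atTop (𝓝 l) := by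
    intro s hs y hy hsy
    refine ⟨_, tendsto_atTop_ciInf (antitone_nat_of_succ_le fun k => ?_)
      ⟨0, by rintro _ ⟨k, rfl⟩; positivity⟩⟩
    refine le_trans (le_add_of_nonneg_left ?_) (hfejer hs hy hsy k)
    positivity
  obtain ⟨l, hl⟩ := hconv s hs t ht hst
  have hsum : Tendsto (fun k => ‖z (k + 1) - z k‖ ^ 2 + ‖D (z k) - D s‖ ^ 2
      + γ ^ 2 * ‖zb (k + 1) - zb k‖ ^ 2) atTop (𝓝 0) := by
    have h1 := (hl.sub ((tendsto_add_atTop_iff_nat 1).2 hl)).const_mul c⁻¹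
    rw [sub_self, mul_zero] at h1
    refine squeeze_zero (fun k => by positivity) (fun k => ?_) h1
    rw [le_inv_mul_iff₀ hc0]
    linarith [hfejer hs ht hst k]
  have hz : Tendsto (fun k => z (k + 1) - z k) atTop (𝓝 0) := by
    refine tendsto_zero_of_mul_sq_norm_le one_pos (fun k => ?_) hsum
    nlinarith [sq_nonneg ‖D (z k) - D s‖, sq_nonneg (γ * ‖zb (k + 1) - zb k‖)]
  have hd : Tendsto (fun k => D (z k) - D s) atTop (𝓝 0) := by
    refine tendsto_zero_of_mul_sq_norm_le one_pos (fun k => ?_) hsum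
    nlinarith [sq_nonneg ‖z (k + 1) - z k‖, sq_nonneg (γ * ‖zb (k + 1) - zb k‖)]
  have hzb : Tendsto (fun k => zb (k + 1) - zb k) atTop (𝓝 0) := by
    refine tendsto_zero_of_mul_sq_norm_le (pow_pos hγ 2) (fun k => ?_) hsum
    nlinarith [sq_nonneg ‖z (k + 1) - z k‖, sq_nonneg ‖D (z k) - D s‖]
  have he : Tendsto (fun k => zt k - z k) atTop (𝓝 0) := by
    simp_rw [hr.sub_eq hγ]
    simpa using hz.sub (hzb.const_smul γ)
  -- boundedness
  obtain ⟨M, hM⟩ : ∃ M, ∀ k, ‖z k‖ ≤ M := by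
    refine exists_norm_le_of_mul_sq_norm_sub_le one_pos (s := s) (fun k => ?_) hl
    nlinarith [sq_nonneg (γ * ‖zb k - t‖)]
  obtain ⟨M', hM'⟩ : ∃ M, ∀ k, ‖zb k‖ ≤ M := by
    refine exists_norm_le_of_mul_sq_norm_sub_le (pow_pos hγ 2) (s := t) (fun k => ?_) hl
    nlinarith [sq_nonneg ‖z k - s‖]
  obtain ⟨Me, hMe⟩ : ∃ M, ∀ k, ‖zt k - z k‖ ≤ M := by
    obtain ⟨M, hM⟩ := he.norm.bddAbove_range
    exact ⟨M, fun k => hM ⟨k, rfl⟩⟩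
  -- weak cluster points are solutions
  have hcluster : ∀ U : Ultrafilter ℕ, (U : Filter ℕ) ≤ atTop → ∃ w ∈ V, ∃ y ∈ Vᗮ,
      y - D w ∈ A w ∧ (∀ v, Tendsto (fun k => ⟪z k, v⟫_ℝ) U (𝓝 ⟪w, v⟫_ℝ)) ∧
      ∀ v, Tendsto (fun k => ⟪zb k, v⟫_ℝ) U (𝓝 ⟪y, v⟫_ℝ) := by
    intro U hU
    obtain ⟨w, hw⟩ := exists_weak_limit_of_bounded U hM
    obtain ⟨y, hy⟩ := exists_weak_limit_of_bounded U hM'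
    have hwV : w ∈ V := by
      have : CompleteSpace V := hV.completeSpace_coe
      rw [← V.orthogonal_orthogonal, Submodule.mem_orthogonal']
      intro v hv
      refine tendsto_nhds_unique (hw v) ?_
      simp only [horth _ (hr.mem _) v hv, tendsto_const_nhds]
    have hyV : y ∈ Vᗮ := by
      rw [Submodule.mem_orthogonal']
      intro v hv
      refine tendsto_nhds_unique (hy v) ?_
      simp only [real_inner_comm v, horth v hv _ (hr.mem_orthogonal _), tendsto_const_nhds]
    -- `D (z k)` tends to `D s` strongly, so cocoercivity between `z k` and `w` passes to the limit
    -- as `β ‖D s - D w‖² ≤ 0`.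
    have hDw : D s = D w := by
      have h1 : Tendsto (fun k => ⟪D (z k) - D s, z k - w⟫_ℝ + ⟪D s - D w, z k - w⟫_ℝ) U
          (𝓝 (0 + 0)) := by
        refine (tendsto_inner_zero_of_bounded (hd.mono_left hU) (M := M + ‖w‖)
          fun k => (norm_sub_le _ _).trans (by linarith [hM k])).add ?_
        simp only [real_inner_comm _ (D s - D w), inner_sub_left _ w]
        simpa only [sub_self] using (hw (D s - D w)).sub_const ⟪w, D s - D w⟫_ℝ
      have h2 : Tendsto (fun k => β * ‖(D (z k) - D s) + (D s - D w)‖ ^ 2) U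
          (𝓝 (β * ‖0 + (D s - D w)‖ ^ 2)) :=
        ((((hd.mono_left hU).add_const _).norm).pow 2).const_mul β
      have h3 := le_of_tendsto_of_tendsto' h2 h1 fun k => by
        rw [← inner_add_left, sub_add_sub_cancel]
        exact hD _ (hr.mem k) _ hwV
      rw [zero_add, zero_add] at h3
      have h4 : ‖D s - D w‖ ^ 2 = 0 := by nlinarith [sq_nonneg ‖D s - D w‖]
      exact sub_eq_zero.1 (norm_eq_zero.1 (pow_eq_zero_iff two_ne_zero |>.1 h4))
    refine ⟨w, hwV, y, hyV, hmax _ _ fun p a hpa => ?_, hw, hy⟩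
    rw [← hDw]
    have hstep : Tendsto (fun k => -(γ⁻¹ • (zt k - z k)) - (D (z k) - D s)) U (𝓝 0) := by
      have := (((he.const_smul γ⁻¹).neg).sub hd).mono_left hU
      simpa using this
    have e1 := tendsto_inner_zero_of_bounded hstep (y := fun k => (zt k - z k) + z k - p)
      (M := Me + M + ‖p‖) fun k => (norm_sub_le _ _).trans
        (by linarith [norm_add_le (zt k - z k) (z k), hM k, hMe k])
    have e2 := tendsto_inner_zero_of_bounded (he.mono_left hU) hM'
    have e3 : Tendsto (fun k => ⟪zt k - z k, D s + a⟫_ℝ) U (𝓝 0) := by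
      simpa using (he.mono_left hU).inner (tendsto_const_nhds (x := D s + a))
    -- The only pairing of two merely weakly convergent sequences, `⟪zb k, z k⟫`, vanishes by
    -- orthogonality; every other term is linear in one of them or has a factor tending strongly to
    -- `0`.
    have hlim := ((((e1.add e2).sub (hy p)).sub (hw (D s + a))).sub e3).add_const ⟪D s + a, p⟫_ℝ
    have hnn := ge_of_tendsto' (b := (0 : ℝ)) hlim fun k => ?_
    · refine hnn.trans_eq ?_
      simp only [inner_sub_left, inner_sub_right, inner_add_left, inner_add_right,
        real_inner_comm w, horth w hwV y hyV]
      ring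
    · have h0 := hmono _ _ _ (hr.resolvent_step k) a hpa
      refine h0.trans_eq ?_
      have h5 := horth _ (hr.mem k) _ (hr.mem_orthogonal k)
      simp only [inner_sub_left, inner_sub_right, inner_add_left, inner_add_right,
        inner_neg_left, real_inner_smul_left, smul_sub]
      linarith [real_inner_comm (zt k) (zb k), real_inner_comm (z k) (zb k),
        real_inner_comm (zt k) (D s), real_inner_comm (z k) (D s), real_inner_comm (zt k) a,
        real_inner_comm (z k) a]
  -- uniqueness of weak cluster points
  have huniq : ∀ w ∈ V, ∀ y ∈ Vᗮ, y - D w ∈ A w → ∀ w' ∈ V, ∀ y' ∈ Vᗮ, y' - D w' ∈ A w' →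
      ∀ U U' : Ultrafilter ℕ, (U : Filter ℕ) ≤ atTop → (U' : Filter ℕ) ≤ atTop →
      (∀ v, Tendsto (fun k => ⟪z k, v⟫_ℝ) U (𝓝 ⟪w, v⟫_ℝ)) →
      (∀ v, Tendsto (fun k => ⟪zb k, v⟫_ℝ) U (𝓝 ⟪y, v⟫_ℝ)) →
      (∀ v, Tendsto (fun k => ⟪z k, v⟫_ℝ) U' (𝓝 ⟪w', v⟫_ℝ)) →
      (∀ v, Tendsto (fun k => ⟪zb k, v⟫_ℝ) U' (𝓝 ⟪y', v⟫_ℝ)) → w = w' := by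
    intro w hw y hy hwy w' hw' y' hy' hwy' U U' hU hU' h1 h2 h3 h4
    obtain ⟨l, hl⟩ := hconv w hw y hy hwy
    obtain ⟨l', hl'⟩ := hconv w' hw' y' hy' hwy'
    -- Opial: in the difference of the two Lyapunov functions the quadratic terms cancel, so this
    -- linear expression converges. Its limits along `U` and `U'` must agree, and they differ by
    -- `‖w' - w‖² + γ² ‖y' - y‖²`.
    have key : Tendsto (fun k => ⟪z k, w' - w⟫_ℝ + γ ^ 2 * ⟪zb k, y' - y⟫_ℝ) atTop
        (𝓝 ((l - l' - (‖w‖ ^ 2 + γ ^ 2 * ‖y‖ ^ 2) + (‖w'‖ ^ 2 + γ ^ 2 * ‖y'‖ ^ 2)) / 2)) := by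
      refine ((((hl.sub hl').sub_const (‖w‖ ^ 2 + γ ^ 2 * ‖y‖ ^ 2)).add_const
        (‖w'‖ ^ 2 + γ ^ 2 * ‖y'‖ ^ 2)).div_const 2).congr fun k => ?_
      simp only [norm_sub_sq_real, inner_sub_right]
      ring
    have ha := tendsto_nhds_unique (key.mono_left hU)
      ((h1 (w' - w)).add ((h2 (y' - y)).const_mul (γ ^ 2)))
    have hb := tendsto_nhds_unique (key.mono_left hU')
      ((h3 (w' - w)).add ((h4 (y' - y)).const_mul (γ ^ 2)))
    rw [ha] at hb
    have h5 : ‖w' - w‖ ^ 2 + γ ^ 2 * ‖y' - y‖ ^ 2 = 0 := by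
      rw [← real_inner_self_eq_norm_sq, ← real_inner_self_eq_norm_sq, inner_sub_left w',
        inner_sub_left y']
      linarith
    have h6 : ‖w' - w‖ ^ 2 = 0 := by nlinarith [sq_nonneg ‖w' - w‖, sq_nonneg (γ * ‖y' - y‖)]
    exact (sub_eq_zero.1 (norm_eq_zero.1 (pow_eq_zero_iff two_ne_zero |>.1 h6))).symm
  obtain ⟨w, hw, y, hy, hwy, h1, h2⟩ := hcluster (Ultrafilter.of atTop) (Ultrafilter.of_le atTop)
  refine ⟨w, hw, ⟨y, hy, hwy⟩, fun v => (tendsto_iff_ultrafilter _ _ _).2 fun U hU => ?_⟩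
  obtain ⟨w', hw', y', hy', hwy', h3, h4⟩ := hcluster U hU
  rw [huniq w hw y hy hwy w' hw' y' hy' hwy' _ U (Ultrafilter.of_le atTop) hU h1 h2 h3 h4]
  exact h3 v

end ForwardPartialInverse

end ForwardPartialInverse

end DRO

namespace DRO

/-! ### Resolvents, maximality and the epigraph projection -/

section Resolvents

variable {E : Type*} [NormedAddCommGroup E] [InnerProductSpace ℝ E]

theorem mem_singleton_add_smul_iff {γ : ℝ} (hγ : γ ≠ 0) {S : Set E} {u y : E} :
    u ∈ {y} + γ • S ↔ γ⁻¹ • (u - y) ∈ S := by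
  rw [singleton_add, ← mem_smul_set_iff_inv_smul_mem₀ hγ]
  simp [sub_eq_neg_add]

theorem smul_sub_resolvent_mem {A : E → Set E} {γ : ℝ} (hγ : γ ≠ 0) {u : E}
    (h : ∃ y, γ⁻¹ • (u - y) ∈ A y) :
    γ⁻¹ • (u - resolvent (fun w => γ • A w) u) ∈ A (resolvent (fun w => γ • A w) u) := by
  rw [← mem_singleton_add_smul_iff hγ]
  obtain ⟨y, hy⟩ := h
  exact Classical.epsilon_spec (p := fun y => u ∈ {y} + γ • A y)
    ⟨y, (mem_singleton_add_smul_iff hγ).2 hy⟩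

/-- The easy half of Minty's theorem: a monotone operator with full resolvent domain is
maximally monotone. -/
theorem mem_of_monotonically_related {A : E → Set E} {γ : ℝ} (hγ : 0 < γ)
    (hsurj : ∀ u, ∃ y, γ⁻¹ • (u - y) ∈ A y) {x u : E}
    (h : ∀ y, ∀ v ∈ A y, 0 ≤ ⟪u - v, x - y⟫_ℝ) : u ∈ A x := by
  obtain ⟨y, hy⟩ := hsurj (x + γ • u)
  have e : u - γ⁻¹ • (x + γ • u - y) = -(γ⁻¹ • (x - y)) := by
    rw [add_sub_right_comm, smul_add, inv_smul_smul₀ hγ.ne']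
    abel
  have h1 := h y _ hy
  rw [e, inner_neg_left, real_inner_smul_left, real_inner_self_eq_norm_sq] at h1
  have h2 : ‖x - y‖ ^ 2 = 0 := by
    have := inv_pos.2 hγ
    nlinarith [sq_nonneg ‖x - y‖]
  obtain rfl : x = y := sub_eq_zero.1 (norm_eq_zero.1 (pow_eq_zero_iff two_ne_zero |>.1 h2))
  rwa [add_sub_cancel_left, inv_smul_smul₀ hγ.ne'] at hy

/-- The point `(x, p)` is the projection of `(a, 0)` onto the epigraph of `b + γ f`. -/
theorem exists_epigraph_projection [CompleteSpace E] {f : E → ℝ} (hf : ConvexOn ℝ univ f)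
    (hc : Continuous f) {γ : ℝ} (hγ : 0 < γ) (a : E) (b : ℝ) :
    ∃ (x : E) (p : ℝ), ∃ u ∈ subdiff f x, 0 ≤ p ∧ b + γ * f x ≤ p ∧
      p * (b + γ * f x - p) = 0 ∧ a - x = (γ * p) • u := by
  let C : Set (WithLp 2 (E × ℝ)) := {v | b + γ * f v.fst ≤ v.snd}
  have hcl : IsClosed C :=
    isClosed_le (continuous_const.add (continuous_const.mul
      (hc.comp (continuous_fst.comp (WithLp.prod_continuous_ofLp 2 E ℝ)))))
      (continuous_snd.comp (WithLp.prod_continuous_ofLp 2 E ℝ))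
  have hconv : Convex ℝ C := by
    intro v hv w hw s t hs ht hst
    have h1 := hf.2 (mem_univ v.fst) (mem_univ w.fst) hs ht hst
    simp only [C, mem_ofPred_eq, smul_eq_mul, WithLp.add_fst, WithLp.add_snd, WithLp.smul_fst,
      WithLp.smul_snd] at hv hw h1 ⊢
    have h2 := mul_le_mul_of_nonneg_left h1 hγ.le
    have h3 := mul_le_mul_of_nonneg_left hv hs
    have h4 := mul_le_mul_of_nonneg_left hw ht
    have h5 : b = s * b + t * b := by rw [← add_mul, hst, one_mul]
    linarith
  obtain ⟨y, hy⟩ := exists_sub_mem_normalCone (C := C)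
    ⟨WithLp.toLp 2 (a, b + γ * f a), le_refl (b + γ * f a)⟩ hcl hconv (WithLp.toLp 2 (a, 0))
  obtain ⟨⟨x, p⟩, rfl⟩ := (WithLp.toLp_surjective 2) y
  have hxp : b + γ * f x ≤ p := hy.1
  -- The variational inequality of the projection. Moving vertically, up and then down to the graph,
  -- gives `0 ≤ p` and complementarity.
  have hvar : ∀ (w : E) (t : ℝ), b + γ * f w ≤ t → ⟪a - x, w - x⟫_ℝ - p * (t - p) ≤ 0 := by
    intro w t hwt
    have := hy.2 (WithLp.toLp 2 (w, t)) hwt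
    simp [WithLp.prod_inner_apply] at this
    linarith
  have hp : 0 ≤ p := by
    have := hvar x (p + 1) (by linarith)
    simp at this
    linarith
  have hcomp : p * (b + γ * f x - p) = 0 := by
    have := hvar x (b + γ * f x) le_rfl
    simp only [sub_self, inner_zero_right] at this
    exact le_antisymm (mul_nonpos_of_nonneg_of_nonpos hp (by linarith)) (by linarith)
  -- If `p = 0`, testing at `a` forces `x = a` and any subgradient serves. If `p > 0`,
  -- complementarity puts the point on the graph, and the inequality along the graph makes `(γ *
  -- p)⁻¹ • (a - x)` a subgradient.
  rcases hp.eq_or_lt with rfl | hp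
  · obtain ⟨u, hu⟩ := subdiff_nonempty hf hc x
    refine ⟨x, 0, u, hu, le_rfl, hxp, by simp, ?_⟩
    have h1 := hvar a (b + γ * f a) le_rfl
    rw [real_inner_self_eq_norm_sq] at h1
    have h2 : ‖a - x‖ ^ 2 = 0 := by nlinarith [sq_nonneg ‖a - x‖]
    rw [mul_zero, zero_smul]
    exact norm_eq_zero.1 (pow_eq_zero_iff two_ne_zero |>.1 h2)
  · have hγp : 0 < γ * p := mul_pos hγ hp
    refine ⟨x, p, (γ * p)⁻¹ • (a - x), fun w => ?_, hp.le, hxp, hcomp,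
      (smul_inv_smul₀ hγp.ne' _).symm⟩
    have h1 := hvar w (b + γ * f w) le_rfl
    have h2 : b + γ * f x = p := by
      rcases mul_eq_zero.1 hcomp with h | h <;> linarith
    rw [real_inner_smul_left]
    have h3 : (γ * p)⁻¹ * ⟪a - x, w - x⟫_ℝ ≤ f w - f x := by
      rw [inv_mul_le_iff₀ hγp]
      nlinarith
    linarith

end Resolvents

/-! ### The operators of the problem on pairs and on the product space -/

section Operators

theorem Pair.ext_fst_snd {H : Type*} {N : ℕ} {v w : Pair H N} (h1 : v.fst = w.fst) (h2 : v.snd = w.snd) : v = w :=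
  WithLp.ofLp_injective 2 (Prod.ext h1 h2)

variable {H : Type*} [NormedAddCommGroup H] [InnerProductSpace ℝ H] {N : ℕ}

theorem isClosed_setP1 : IsClosed (setP1 N) :=
  isClosed_eq (by fun_prop) continuous_const

theorem convex_setP1 : Convex ℝ (setP1 N) := by
  intro x hx y hy s t hs ht hst
  have hx' : ∑ i, x i = 1 := hx
  have hy' : ∑ i, y i = 1 := hy
  change ∑ i, (s * x i + t * y i) = 1
  rw [Finset.sum_add_distrib, ← Finset.mul_sum, ← Finset.mul_sum, hx', hy', mul_one, mul_one, hst]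

theorem inner_mkPair (v w : Pair H N) :
    ⟪v, w⟫_ℝ = ⟪v.fst, w.fst⟫_ℝ + ⟪v.snd, w.snd⟫_ℝ :=
  WithLp.prod_inner_apply v w

/-- The subgradient inequalities, weighted by the nonnegative `i`-th coordinates, produce exactly
the differences of `f i` that the second component subtracts. -/
theorem opB_monotone (f : Fin N → H → ℝ) (i : Fin N) (x y : Pair H N) :
    ∀ u ∈ opB f i x, ∀ v ∈ opB f i y, 0 ≤ ⟪u - v, x - y⟫_ℝ := by
  rintro _ ⟨u, hu, s, hs, rfl⟩ _ ⟨v, hv, t, ht, rfl⟩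
  have h1 := normalCone_monotone hs ht
  have h2 := mul_le_mul_of_nonneg_left (hu y.fst) hs.1
  have h3 := mul_le_mul_of_nonneg_left (hv x.fst) ht.1
  rw [← neg_sub, inner_neg_right] at h2
  have e1 : ⟪s - t, x.snd i - y.snd i⟫_ℝ = (x.snd i - y.snd i) * (s - t) := rfl
  rw [e1] at h1
  have e2 : ⟪mkPair (x.snd i • u) (EuclideanSpace.single i (s - f i x.fst))
      - mkPair (y.snd i • v) (EuclideanSpace.single i (t - f i y.fst)), x - y⟫_ℝ
      = ⟪x.snd i • u - y.snd i • v, x.fst - y.fst⟫_ℝ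
        + ⟪EuclideanSpace.single i (s - f i x.fst) - EuclideanSpace.single i (t - f i y.fst),
          x.snd - y.snd⟫_ℝ := inner_mkPair _ _
  rw [e2]
  simp only [inner_sub_left _ _ (x.fst - y.fst), inner_sub_left _ _ (x.snd - y.snd),
    real_inner_smul_left, EuclideanSpace.inner_single_left, PiLp.sub_apply, conj_trivial]
  linarith

/-- The resolvent equation asks for `w.fst - x = γ p u` with `p = max 0 (w.snd i + γ f_i(x))`, the
optimality system of the epigraph projection. The other coordinates of `w.snd` stay unchanged. -/
theorem opB_exists_resolvent [CompleteSpace H] {f : Fin N → H → ℝ} {i : Fin N}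
    (hf : ConvexOn ℝ univ (f i)) (hc : Continuous (f i)) {γ : ℝ} (hγ : 0 < γ) (w : Pair H N) :
    ∃ y, γ⁻¹ • (w - y) ∈ opB f i y := by
  obtain ⟨x, p, u, hu, hp, hxp, hcomp, hax⟩ :=
    exists_epigraph_projection hf hc hγ w.fst (w.snd i)
  obtain ⟨r, hri, hr⟩ : ∃ r : EuclideanSpace ℝ (Fin N), r i = p ∧
      w.snd - r = EuclideanSpace.single i (w.snd i - p) := by
    refine ⟨w.snd - EuclideanSpace.single i (w.snd i - p), ?_, sub_sub_cancel _ _⟩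
    simp
  subst hri
  have hs : γ⁻¹ * (w.snd i + γ * f i x - r i) = γ⁻¹ * (w.snd i - r i) + f i x := by
    rw [add_sub_right_comm, mul_add, inv_mul_cancel_left₀ hγ.ne']
  refine ⟨mkPair x r, u, hu, γ⁻¹ * (w.snd i + γ * f i x - r i), ⟨hp, fun t ht => ?_⟩,
    Pair.ext_fst_snd ?_ ?_⟩
  · change (t - r i) * (γ⁻¹ * (w.snd i + γ * f i x - r i)) ≤ 0
    have h1 : t * (w.snd i + γ * f i x - r i) ≤ 0 :=
      mul_nonpos_of_nonneg_of_nonpos ht (by linarith)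
    rw [mul_left_comm, sub_mul, hcomp, sub_zero]
    exact mul_nonpos_of_nonneg_of_nonpos (inv_pos.2 hγ).le h1
  · change γ⁻¹ • (w.fst - x) = r i • u
    rw [hax, mul_smul, inv_smul_smul₀ hγ.ne']
  · change γ⁻¹ • (w.snd - r)
      = EuclideanSpace.single i (γ⁻¹ * (w.snd i + γ * f i x - r i) - f i x)
    rw [hr, hs, add_sub_cancel_right, ← smul_eq_mul]
    ext j
    by_cases hj : j = i <;> simp [hj]

theorem opA1_monotone (Q : Set H) (x y : Pair H N) :
    ∀ u ∈ opA1 Q x, ∀ v ∈ opA1 Q y, 0 ≤ ⟪u - v, x - y⟫_ℝ := by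
  intro u hu v hv
  rw [inner_mkPair]
  exact add_nonneg (normalCone_monotone hu.1 hv.1) (normalCone_monotone hu.2 hv.2)

theorem opA_monotone (P : Set (EuclideanSpace ℝ (Fin N))) (x y : Pair H N) :
    ∀ u ∈ opA P x, ∀ v ∈ opA P y, 0 ≤ ⟪u - v, x - y⟫_ℝ := by
  intro u hu v hv
  rw [inner_mkPair, WithLp.sub_fst, hu.1, hv.1, sub_self, inner_zero_left, zero_add]
  exact normalCone_monotone hu.2 hv.2

theorem opA1_proj [CompleteSpace H] {Q : Set H} (hne : Q.Nonempty) (hcl : IsClosed Q)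
    (hconv : Convex ℝ Q) (h1 : (setP1 N).Nonempty) {γ : ℝ} (hγ : 0 < γ) (x : H)
    (p : EuclideanSpace ℝ (Fin N)) :
    γ⁻¹ • (mkPair x p - mkPair (proj Q x) (proj (setP1 N) p)) ∈
      opA1 Q (mkPair (proj Q x) (proj (setP1 N) p)) := by
  exact ⟨smul_mem_normalCone (sub_proj_mem_normalCone hne hcl hconv _) (inv_pos.2 hγ).le,
    smul_mem_normalCone (sub_proj_mem_normalCone h1 isClosed_setP1 convex_setP1 _)
      (inv_pos.2 hγ).le⟩

theorem opA_proj {P : Set (EuclideanSpace ℝ (Fin N))} (hne : P.Nonempty)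
    (hcl : IsClosed P) (hconv : Convex ℝ P) {γ : ℝ} (hγ : 0 < γ) (x : H)
    (p : EuclideanSpace ℝ (Fin N)) :
    γ⁻¹ • (mkPair x p - mkPair x (proj P p)) ∈ opA P (mkPair x (proj P p)) := by
  refine ⟨?_, smul_mem_normalCone (sub_proj_mem_normalCone hne hcl hconv _) (inv_pos.2 hγ).le⟩
  change γ⁻¹ • (x - x) = 0
  rw [sub_self, smul_zero]

theorem mem_opATilde {f : Fin N → H → ℝ} {Q : Set H} {P : Set (EuclideanSpace ℝ (Fin N))}
    {z v : Stack H N} : v ∈ opATilde f Q P z ↔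
      (∀ i : Fin N, v (Fin.castAdd 2 i) ∈ opB f i (z (Fin.castAdd 2 i))) ∧
      v (Fin.natAdd N 0) ∈ opA1 Q (z (Fin.natAdd N 0)) ∧
      v (Fin.natAdd N 1) ∈ opA P (z (Fin.natAdd N 1)) := by
  constructor
  · intro h
    refine ⟨fun i => ?_, ?_, ?_⟩
    · simpa only [Fin.append_left] using h (Fin.castAdd 2 i)
    · have := h (Fin.natAdd N 0)
      rw [Fin.append_right] at this
      exact this
    · have := h (Fin.natAdd N 1)
      rw [Fin.append_right] at this
      exact this
  · rintro ⟨h1, h2, h3⟩ i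
    induction i using Fin.addCases with
    | left i =>
      rw [Fin.append_left]
      exact h1 i
    | right j =>
      rw [Fin.append_right]
      fin_cases j
      · exact h2
      · exact h3

theorem opATilde_monotone (f : Fin N → H → ℝ) (Q : Set H) (P : Set (EuclideanSpace ℝ (Fin N)))
    (x y : Stack H N) :
    ∀ u ∈ opATilde f Q P x, ∀ v ∈ opATilde f Q P y, 0 ≤ ⟪u - v, x - y⟫_ℝ := by
  intro u hu v hv
  rw [PiLp.inner_apply]
  rw [mem_opATilde] at hu hv
  refine Finset.sum_nonneg fun i _ => ?_
  induction i using Fin.addCases with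
  | left i => exact opB_monotone f i _ _ _ (hu.1 i) _ (hv.1 i)
  | right j =>
    fin_cases j
    · exact opA1_monotone Q _ _ _ hu.2.1 _ hv.2.1
    · exact opA_monotone P _ _ _ hu.2.2 _ hv.2.2

theorem opATilde_exists_resolvent [CompleteSpace H] {f : Fin N → H → ℝ} {Q : Set H}
    {P : Set (EuclideanSpace ℝ (Fin N))} (hf : ∀ i, ConvexOn ℝ univ (f i))
    (hc : ∀ i, Continuous (f i)) (hQne : Q.Nonempty) (hQcl : IsClosed Q) (hQconv : Convex ℝ Q)
    (h1 : (setP1 N).Nonempty) (hPne : P.Nonempty) (hPcl : IsClosed P) (hPconv : Convex ℝ P)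
    {γ : ℝ} (hγ : 0 < γ) (w : Stack H N) : ∃ y, γ⁻¹ • (w - y) ∈ opATilde f Q P y := by
  choose y hy using fun i : Fin N =>
    opB_exists_resolvent (hf i) (hc i) hγ (w (Fin.castAdd 2 i))
  refine ⟨WithLp.toLp 2 (Fin.append y
      ![mkPair (proj Q (w (Fin.natAdd N 0)).fst) (proj (setP1 N) (w (Fin.natAdd N 0)).snd),
        mkPair (w (Fin.natAdd N 1)).fst (proj P (w (Fin.natAdd N 1)).snd)]), mem_opATilde.2 ⟨fun i => ?_, ?_, ?_⟩⟩
  · simpa only [PiLp.smul_apply, PiLp.sub_apply, Fin.append_left] using hy i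
  · simp only [PiLp.smul_apply, PiLp.sub_apply, Fin.append_right, Matrix.cons_val_zero]
    exact opA1_proj hQne hQcl hQconv h1 hγ _ _
  · simp only [PiLp.smul_apply, PiLp.sub_apply, Fin.append_right, Matrix.cons_val_one,
      Matrix.cons_val_zero]
    exact opA_proj hPne hPcl hPconv hγ (w (Fin.natAdd N 1)).fst (w (Fin.natAdd N 1)).snd

/-! ### The diagonal and the projected gradient -/

theorem mem_diag_orthogonal {v : Stack H N} : v ∈ (diag H N)ᗮ ↔ ∑ i, v i = 0 := by
  have key : ∀ d ∈ diag H N, ⟪d, v⟫_ℝ = ⟪d 0, ∑ i, v i⟫_ℝ := by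
    intro d hd
    rw [PiLp.inner_apply, inner_sum]
    exact Finset.sum_congr rfl fun i _ => by rw [hd i 0]
  rw [Submodule.mem_orthogonal]
  refine ⟨fun h => ?_, fun h d hd => by rw [key d hd, h, inner_zero_right]⟩
  have hd : (WithLp.toLp 2 fun _ => ∑ i, v i : Stack H N) ∈ diag H N := fun i j => rfl
  have := h _ hd
  rw [key _ hd] at this
  exact inner_self_eq_zero.1 this

theorem isClosed_diag : IsClosed (diag H N : Set (Stack H N)) := by
  have : (diag H N : Set (Stack H N)) = ⋂ i, ⋂ j, {z | z i = z j} := by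
    ext z
    simp only [mem_iInter, mem_ofPred_eq]
    rfl
  rw [this]
  refine isClosed_iInter fun i => isClosed_iInter fun j => isClosed_eq ?_ ?_ <;> fun_prop

/-- The projection of `opCTilde h` onto the diagonal. -/
noncomputable def opD [CompleteSpace H] (h : H → ℝ) (z : Stack H N) : Stack H N :=
  WithLp.toLp 2 fun _ => mkPair (((N : ℝ) + 2)⁻¹ • gradient h (z 0).fst) 0

theorem opD_mem_diag [CompleteSpace H] (h : H → ℝ) (z : Stack H N) : opD h z ∈ diag H N :=
  fun _ _ => rfl

theorem opCTilde_sub_opD_mem [CompleteSpace H] (h : H → ℝ) (z : Stack H N) :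
    opCTilde h z - opD h z ∈ (diag H N)ᗮ := by
  have hN : (N : ℝ) + 2 ≠ 0 := by positivity
  rw [mem_diag_orthogonal]
  simp only [PiLp.sub_apply, opCTilde, opD, Finset.sum_sub_distrib, Finset.sum_ite_eq',
    Finset.mem_univ, if_true, Finset.sum_const, Finset.card_univ, Fintype.card_fin]
  refine sub_eq_zero.2 (Pair.ext_fst_snd ?_ ?_)
  · change _ = (N + 2) • (((N : ℝ) + 2)⁻¹ • gradient h (z 0).fst)
    rw [← Nat.cast_smul_eq_nsmul ℝ, Nat.cast_add, Nat.cast_ofNat, smul_inv_smul₀ hN]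
    rfl
  · change _ = (N + 2) • (0 : EuclideanSpace ℝ (Fin N))
    rw [smul_zero]
    rfl

/-- Spreading the gradient over `N + 2` equal blocks keeps the inner product with diagonal vectors
but divides the squared norm by `N + 2`. The constant could be `(N + 2) β`; `β` suffices for `γ <
2β`. -/
theorem opD_cocoercive [CompleteSpace H] {h : H → ℝ} {β : ℝ} (hβ : 0 < β)
    (hcoc : ∀ x y, β * ‖gradient h x - gradient h y‖ ^ 2
      ≤ ⟪gradient h x - gradient h y, x - y⟫_ℝ) :
    ∀ x ∈ diag H N, ∀ y ∈ diag H N, β * ‖opD h x - opD h y‖ ^ 2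
      ≤ ⟪opD h x - opD h y, x - y⟫_ℝ := by
  intro x hx y hy
  have hN : (0 : ℝ) < N + 2 := by positivity
  set g := gradient h (x 0).fst - gradient h (y 0).fst with hg
  have hi : ∀ w : Stack H N, ⟪opD h x - opD h y, w⟫_ℝ
      = ∑ i, ((N : ℝ) + 2)⁻¹ * ⟪g, (w i).fst⟫_ℝ := by
    intro w
    rw [PiLp.inner_apply]
    refine Finset.sum_congr rfl fun i _ => ?_
    have e : (opD h x - opD h y) i = mkPair (((N : ℝ) + 2)⁻¹ • g) 0 :=
      Pair.ext_fst_snd (smul_sub _ _ _).symm (sub_zero _)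
    rw [e, inner_mkPair]
    change ⟪((N : ℝ) + 2)⁻¹ • g, (w i).fst⟫_ℝ + ⟪(0 : EuclideanSpace ℝ (Fin N)), (w i).snd⟫_ℝ = _
    rw [real_inner_smul_left, inner_zero_left, add_zero]
  have hconst : ∀ r : ℝ, ∑ _i : Fin (N + 2), ((N : ℝ) + 2)⁻¹ * r = r := by
    intro r
    simp only [Finset.sum_const, Finset.card_univ, Fintype.card_fin, nsmul_eq_mul, Nat.cast_add,
      Nat.cast_ofNat]
    exact mul_inv_cancel_left₀ hN.ne' r
  have h1 : ⟪opD h x - opD h y, x - y⟫_ℝ = ⟪g, (x 0).fst - (y 0).fst⟫_ℝ := by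
    rw [hi, ← hconst ⟪g, (x 0).fst - (y 0).fst⟫_ℝ]
    refine Finset.sum_congr rfl fun i _ => ?_
    rw [PiLp.sub_apply, hx i 0, hy i 0, WithLp.sub_fst]
  have h2 : ‖opD h x - opD h y‖ ^ 2 = ((N : ℝ) + 2)⁻¹ * ‖g‖ ^ 2 := by
    rw [← real_inner_self_eq_norm_sq, hi, ← hconst (((N : ℝ) + 2)⁻¹ * ‖g‖ ^ 2)]
    refine Finset.sum_congr rfl fun i _ => ?_
    have e : ((opD h x - opD h y) i).fst = ((N : ℝ) + 2)⁻¹ • g := (smul_sub _ _ _).symm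
    rw [e, real_inner_smul_right, real_inner_self_eq_norm_sq]
  rw [h1, h2]
  refine le_trans (mul_le_mul_of_nonneg_left ?_ hβ.le) (hcoc _ _)
  refine mul_le_of_le_one_left (sq_nonneg _) (inv_le_one_of_one_le₀ ?_)
  have : (0 : ℝ) ≤ N := Nat.cast_nonneg N
  linarith

/-- The normal cone of the diagonal is a linear space there, so it absorbs `opCTilde h z - opD h z`.
-/
theorem isSolution_iff [CompleteSpace H] {h : H → ℝ} {f : Fin N → H → ℝ} {Q : Set H}
    {P : Set (EuclideanSpace ℝ (Fin N))} {z : Stack H N} :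
    IsSolution h f Q P z ↔
      z ∈ diag H N ∧ ∃ y ∈ (diag H N)ᗮ, y - opD h z ∈ opATilde f Q P z := by
  constructor
  · rintro ⟨_, ⟨a, ha, _, rfl, rfl⟩, n, hn, he⟩
    rw [mem_normalCone_submodule] at hn
    simp only at he
    refine ⟨hn.1, a + opD h z, ?_, by rwa [add_sub_cancel_right]⟩
    have : a + opD h z = -n - (opCTilde h z - opD h z) := by
      rw [eq_neg_of_add_eq_zero_right he]
      abel
    rw [this]
    exact (diag H N)ᗮ.sub_mem ((diag H N)ᗮ.neg_mem hn.2) (opCTilde_sub_opD_mem h z)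
  · rintro ⟨hz, y, hy, ha⟩
    refine ⟨_, ⟨_, ha, _, rfl, rfl⟩, -y - (opCTilde h z - opD h z), ?_, ?_⟩
    · rw [mem_normalCone_submodule]
      exact ⟨hz, (diag H N)ᗮ.sub_mem ((diag H N)ᗮ.neg_mem hy) (opCTilde_sub_opD_mem h z)⟩
    · simp only
      abel

theorem IsRoutine.forwardPartialInverse [CompleteSpace H] {h : H → ℝ} {f : Fin N → H → ℝ}
    {Q : Set H} {P : Set (EuclideanSpace ℝ (Fin N))} {γ : ℝ} {z zbar ztil : ℕ → Stack H N}
    (hr : IsRoutine h f Q P γ z zbar ztil) (hz : z 0 ∈ diag H N) (hzbar : zbar 0 ∈ (diag H N)ᗮ)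
    (hf : ∀ i, ConvexOn ℝ univ (f i)) (hc : ∀ i, Continuous (f i))
    (hQne : Q.Nonempty) (hQcl : IsClosed Q) (hQconv : Convex ℝ Q)
    (h1 : (setP1 N).Nonempty) (hPne : P.Nonempty) (hPcl : IsClosed P) (hPconv : Convex ℝ P)
    (hγ : 0 < γ) :
    ForwardPartialInverse (diag H N) (opATilde f Q P) (opD h) γ z zbar ztil := by
  have hproj : ∀ k, z (k + 1) - ztil k ∈ (diag H N)ᗮ := by
    intro k
    have hN : (N : ℝ) + 2 ≠ 0 := by positivity
    rw [mem_diag_orthogonal]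
    simp only [PiLp.sub_apply, hr.step_z, Finset.sum_sub_distrib, Finset.sum_const,
      Finset.card_univ, Fintype.card_fin]
    rw [← Nat.cast_smul_eq_nsmul ℝ, Nat.cast_add, Nat.cast_ofNat, one_div, smul_inv_smul₀ hN,
      sub_self]
  have hdual : ∀ k, zbar (k + 1) = zbar k + γ⁻¹ • (z (k + 1) - ztil k) := by
    intro k
    ext1 i
    have := hr.step_zbar k i
    rw [one_div] at this
    exact this
  refine ⟨?_, ?_, ?_, hproj, hdual⟩
  · rintro (_ | k)
    · exact hz
    · intro i j
      rw [hr.step_z, hr.step_z]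
  · intro k
    induction k with
    | zero => exact hzbar
    | succ k ih =>
      rw [hdual]
      exact (diag H N)ᗮ.add_mem ih ((diag H N)ᗮ.smul_mem _ (hproj k))
  · intro k
    -- The factor `γ / (N + 2)` in every block is `γ` times the factor in `opD`, so each block is
    -- one resolvent step.
    have hfwd : ∀ i, (γ⁻¹ • (z k - ztil k) + zbar k - opD h (z k)) i = γ⁻¹ •
        (mkPair ((z k i).fst + γ • (zbar k i).fst - (γ / (N + 2)) • gradient h (z k 0).fst)
          ((z k i).snd + γ • (zbar k i).snd) - ztil k i) := by
      intro i
      refine Pair.ext_fst_snd ?_ ?_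
      · change γ⁻¹ • ((z k i).fst - (ztil k i).fst) + (zbar k i).fst
          - ((N : ℝ) + 2)⁻¹ • gradient h (z k 0).fst = γ⁻¹ • ((z k i).fst + γ • (zbar k i).fst
            - (γ / (N + 2)) • gradient h (z k 0).fst - (ztil k i).fst)
        rw [div_eq_mul_inv, mul_smul, smul_sub, smul_sub, smul_sub, smul_add,
          inv_smul_smul₀ hγ.ne', inv_smul_smul₀ hγ.ne']
        abel
      · change γ⁻¹ • ((z k i).snd - (ztil k i).snd) + (zbar k i).snd - 0
          = γ⁻¹ • ((z k i).snd + γ • (zbar k i).snd - (ztil k i).snd)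
        rw [smul_sub, smul_sub, smul_add, inv_smul_smul₀ hγ.ne']
        abel
    refine mem_opATilde.2 ⟨fun i => ?_, ?_, ?_⟩
    · rw [hfwd, hr.step_B]
      exact smul_sub_resolvent_mem hγ.ne' (opB_exists_resolvent (hf i) (hc i) hγ _)
    · rw [hfwd, hr.step_A1]
      exact opA1_proj hQne hQcl hQconv h1 hγ _ _
    · rw [hfwd, hr.step_A]
      exact opA_proj hPne hPcl hPconv hγ _ _

theorem IsRoutine.weaklyConverges [CompleteSpace H] {h : H → ℝ} {f : Fin N → H → ℝ}
    {Q : Set H} {P : Set (EuclideanSpace ℝ (Fin N))} {β γ : ℝ} {z zbar ztil : ℕ → Stack H N}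
    (hr : IsRoutine h f Q P γ z zbar ztil) (hz : z 0 ∈ diag H N) (hzbar : zbar 0 ∈ (diag H N)ᗮ)
    (hβ : 0 < β) (hconv : ConvexOn ℝ univ h) (hdiff : Differentiable ℝ h)
    (hlip : ∀ x y, ‖gradient h x - gradient h y‖ ≤ β⁻¹ * ‖x - y‖)
    (hf : ∀ i, ConvexOn ℝ univ (f i)) (hlsc : ∀ i, LowerSemicontinuous (f i))
    (hQne : Q.Nonempty) (hQcl : IsClosed Q) (hQconv : Convex ℝ Q)
    (hPcl : IsClosed P) (hPconv : Convex ℝ P) (hγ : 0 < γ) (hγβ : γ < 2 * β)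
    (hsol : ∃ z, IsSolution h f Q P z) :
    ∃ zlim ∈ diag H N, IsSolution h f Q P zlim ∧ WeaklyConverges z zlim := by
  obtain ⟨s, hs⟩ := hsol
  obtain ⟨hsV, y, hy, hsy⟩ := isSolution_iff.1 hs
  have hsy' := mem_opATilde.1 hsy
  -- Normal cones are empty off their sets, so the given solution witnesses that both sets to be
  -- projected onto are nonempty.
  have h1 : (setP1 N).Nonempty := ⟨_, hsy'.2.1.2.1⟩
  have hPne : P.Nonempty := ⟨_, hsy'.2.2.2.1⟩
  have hc := fun i => continuous_of_convexOn_of_lowerSemicontinuous (hf i) (hlsc i)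
  have hsurj : ∀ w : Stack H N, ∃ y, γ⁻¹ • (w - y) ∈ opATilde f Q P y :=
    opATilde_exists_resolvent hf hc hQne hQcl hQconv h1 hPne hPcl hPconv hγ
  have hmax : ∀ x u : Stack H N, (∀ y, ∀ v ∈ opATilde f Q P y, 0 ≤ ⟪u - v, x - y⟫_ℝ) →
      u ∈ opATilde f Q P x := fun x u hu => mem_of_monotonically_related hγ hsurj hu
  have hD := opD_cocoercive (N := N) hβ (gradient_cocoercive hβ hconv hdiff hlip)
  have hiter := hr.forwardPartialInverse hz hzbar hf hc hQne hQcl hQconv h1 hPne hPcl hPconv hγ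
  have hsol : ∃ s ∈ diag H N, ∃ y ∈ (diag H N)ᗮ, y - opD h s ∈ opATilde f Q P s :=
    ⟨s, hsV, y, hy, hsy⟩
  obtain ⟨w, hw, hwy, hlim⟩ := hiter.exists_weak_limit isClosed_diag hγ hγβ
    (opATilde_monotone f Q P) hmax (opD_mem_diag h) hD hsol
  exact ⟨w, hw, isSolution_iff.2 ⟨hw, hwy⟩, weaklyConverges_of_inner hlim⟩

/-! ### Closedness and convexity of the ambiguity sets -/

theorem isClosed_setP2 (q : Fin N → ℝ) : IsClosed (setP2 q) := by
  simp only [setP2, ofPred_forall]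
  exact isClosed_iInter fun i => isClosed_le (by fun_prop) continuous_const

theorem convex_setP2 (q : Fin N → ℝ) : Convex ℝ (setP2 q) := by
  intro x hx y hy s t hs ht hst i
  change s * x i + t * y i ≤ q i
  have h1 := mul_le_mul_of_nonneg_left (hx i) hs
  have h2 := mul_le_mul_of_nonneg_left (hy i) ht
  have h3 : s * q i + t * q i = q i := by rw [← add_mul, hst, one_mul]
  linarith

theorem isClosed_setP3 (ξ : Fin N → ℝ) (μm μp : ℝ) : IsClosed (setP3 ξ μm μp) := by
  have hc : Continuous fun p : EuclideanSpace ℝ (Fin N) => ∑ i, p i * ξ i := by fun_prop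
  exact (isClosed_le continuous_const hc).inter (isClosed_le hc continuous_const)

theorem convex_setP3 (ξ : Fin N → ℝ) (μm μp : ℝ) : Convex ℝ (setP3 ξ μm μp) := by
  rintro x ⟨hx1, hx2⟩ y ⟨hy1, hy2⟩ s t hs ht hst
  have h : ∑ i, (s • x + t • y) i * ξ i = s * ∑ i, x i * ξ i + t * ∑ i, y i * ξ i := by
    rw [Finset.mul_sum, Finset.mul_sum, ← Finset.sum_add_distrib]
    refine Finset.sum_congr rfl fun i _ => ?_
    simp only [PiLp.add_apply, PiLp.smul_apply, smul_eq_mul]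
    ring
  have hcomb : ∀ c : ℝ, s * c + t * c = c := fun c => by rw [← add_mul, hst, one_mul]
  constructor
  · rw [h, ← hcomb μm]
    gcongr
  · rw [h, ← hcomb μp]
    gcongr

end Operators

end DRO

theorem mainTheorem11 {H : Type*} [NormedAddCommGroup H] [InnerProductSpace ℝ H] [CompleteSpace H]
    (N : ℕ)
    (Q : Set H) (hQne : Q.Nonempty) (hQcl : IsClosed Q) (hQconv : Convex ℝ Q)
    (β : ℝ) (hβ : 0 < β)
    (h : H → ℝ) (hconv : ConvexOn ℝ Set.univ h) (hdiff : Differentiable ℝ h)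
    (hlip : ∀ x y, ‖gradient h x - gradient h y‖ ≤ β⁻¹ * ‖x - y‖)
    (f : Fin N → H → ℝ) (fconv : ∀ i, ConvexOn ℝ Set.univ (f i))
    (flsc : ∀ i, LowerSemicontinuous (f i))
    (q : Fin N → ℝ) (ξ : Fin N → ℝ) (μm μp : ℝ)
    (γ : ℝ) (hγ : 0 < γ) (hγβ : γ < 2 * β) :
    ((∃ z, IsSolution h f Q (setP2 q) z) →
      ∀ z zbar ztil : ℕ → Stack H N, z 0 ∈ diag H N → zbar 0 ∈ (diag H N)ᗮ →
        IsRoutine h f Q (setP2 q) γ z zbar ztil →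
        ∃ zlim ∈ diag H N, IsSolution h f Q (setP2 q) zlim ∧ WeaklyConverges z zlim) ∧
    ((∃ z, IsSolution h f Q (setP3 ξ μm μp) z) →
      ∀ z zbar ztil : ℕ → Stack H N, z 0 ∈ diag H N → zbar 0 ∈ (diag H N)ᗮ →
        IsRoutine h f Q (setP3 ξ μm μp) γ z zbar ztil →
        ∃ zlim ∈ diag H N, IsSolution h f Q (setP3 ξ μm μp) zlim ∧ WeaklyConverges z zlim) := by
  exact ⟨fun hsol _ _ _ hz hzbar hr => hr.weaklyConverges hz hzbar hβ hconv hdiff hlip fconv flsc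
      hQne hQcl hQconv (isClosed_setP2 q) (convex_setP2 q) hγ hγβ hsol,
    fun hsol _ _ _ hz hzbar hr => hr.weaklyConverges hz hzbar hβ hconv hdiff hlip fconv flsc
      hQne hQcl hQconv (isClosed_setP3 ξ μm μp) (convex_setP3 ξ μm μp) hγ hγβ hsol⟩
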